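/- For graphs $G,H$ and a positive integer $r$ write $G\to(H)_r$ if every colouring of the edges of $G$ with $r$ colours contains a monochromatic copy of $H$, and let the $r$-colour size Ramsey number $\hat R(H,r)$ be the minimal number of edges of a finite graph $G$ with $G\to(H)_r$. Let $P_n$ denote the path on $n$ vertices. Then: (i) There is a function $\varepsilon:\mathbb{N}\to\mathbb{R}$ with $\varepsilon(r)\to 0$ as $r\to\infty$ such that for every integer $r\ge 1$ and all sufficiently large $n$ (depending on $r$), $\hat R(P_n,r)\le r^{2+\varepsilon(r)}\,n$. (ii) For every real $C>5$, every integer $r\ge 2$ and all sufficiently large $n$ (depending on $C$ and $r$), $\hat R(P_n,r)<400^5\,C\,r^{2+\frac{1}{C-4}}\,n$. In particular, these size Ramsey numbers are finite for all sufficiently large $n$. -/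

import Mathlib

open Filter Topology

/-- The arrow relation `G → (H)_r`: every colouring of the edges of `G` with `r` colours contains a
monochromatic (not necessarily induced) copy of `H`. -/
def RamseyArrow {V W : Type*} (G : SimpleGraph V) (H : SimpleGraph W) (r : ℕ) : Prop :=
  ∀ φ : G.EdgeLabeling (Fin r), ∃ c : Fin r, H.IsContained (φ.labelGraph c)

/-- The `r`-colour size Ramsey number of `H`: the minimal number of edges of a finite graph `G`
with `G → (H)_r`. It takes values in `ℕ∞`, so that it would be `⊤` if there were no such `G`. -/
noncomputable def sizeRamseyNumber {W : Type*} (H : SimpleGraph W) (r : ℕ) : ℕ∞ :=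
  sInf {m : ℕ∞ | ∃ (N : ℕ) (G : SimpleGraph (Fin N)), RamseyArrow G H r ∧ m = G.edgeSet.encard}

/-! Both parts follow from an `O(r² log r) n` bound. Take a random multigraph with `N = 48rn`
vertices and `M = rt(48r+1)` edges, `t = (14+2l)n`, `l = ⌈log₂ r⌉`. By a union bound, some outcome
has fewer than `t` edges inside every `2n`-set (`exists_locally_sparse_multigraph`). If a colour
class has no `P_n`, depth-first search gives `n` vertices with fewer than `n` outer neighbours. All
edges at these vertices lie in a `2n`-set, so deleting them costs at most `t-1` edges. Iterating,
each colour has at most `(t-1)(48r+1)` edges (`card_edges_le_of_not_isContained`), and `r` colours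
cannot exhaust all `M`. -/

lemma pathGraph_isContained_of_isChain {V : Type*} {H : SimpleGraph V} {l : List V} {n : ℕ}
    (hc : l.IsChain H.Adj) (hd : l.Nodup) (hn : n ≤ l.length) :
    (SimpleGraph.pathGraph n).IsContained H := by
  rw [List.isChain_iff_getElem] at hc
  refine ⟨SimpleGraph.Hom.toCopy ⟨fun i => l[(i : ℕ)], ?_⟩ ?_⟩
  · intro a b hab
    rw [SimpleGraph.pathGraph_adj] at hab
    rcases hab with h | h
    · simpa [h] using hc a (by omega)
    · simpa [h] using (hc b (by omega)).symm
  · intro a b hab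
    exact Fin.ext ((hd.getElem_inj_iff).1 hab)

/-! ### Depth-first search and sparsity of graphs without long paths -/

/-- A depth-first search: after `j` vertices are finished, the stack `l` is a path separating the
finished vertices from the unseen ones. -/
lemma exists_finset_list_separating {V : Type*} [DecidableEq V] (H : SimpleGraph V)
    (W : Finset V) (j : ℕ) (hj : j ≤ W.card) :
    ∃ S ⊆ W, S.card = j ∧ ∃ l : List V, l.IsChain H.Adj ∧ l.Nodup ∧ (∀ v ∈ l, v ∈ W \ S) ∧
      ∀ u ∈ S, ∀ w ∈ W \ S, H.Adj u w → w ∈ l := by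
  induction j with
  | zero => exact ⟨∅, by simp, by simp, [], by simp⟩
  | succ j ih =>
    obtain ⟨S, hSW, hSj, hl⟩ := ih (by omega)
    -- For fixed `S`, take a longest valid stack: its top has no unseen neighbour off the stack, so
    -- it can be popped into `S`.
    set P : ℕ → Prop := fun k => ∃ l : List V, l.length = k ∧ l.IsChain H.Adj ∧ l.Nodup ∧
      (∀ v ∈ l, v ∈ W \ S) ∧ ∀ u ∈ S, ∀ w ∈ W \ S, H.Adj u w → w ∈ l
    have hbound : ∀ k, P k → k ≤ W.card := by
      rintro k ⟨l, rfl, -, hd, hm, -⟩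
      rw [← List.toFinset_card_of_nodup hd]
      refine Finset.card_le_card fun v hv => ?_
      exact (Finset.mem_sdiff.1 (hm v (List.mem_toFinset.1 hv))).1
    obtain ⟨l₀, h₀⟩ := hl
    have hP₀ : P l₀.length := ⟨l₀, rfl, h₀⟩
    classical
    have hmax := Nat.findGreatest_spec (hbound _ hP₀) hP₀
    have hno := fun k => Nat.findGreatest_is_greatest (P := P) (n := W.card) (k := k)
    set m := Nat.findGreatest P W.card
    have hno' : ¬ P (m + 1) := fun h => hno (m + 1) (by omega) (hbound _ h) h
    obtain ⟨l, hlm, hc, hd, hm, hs⟩ := hmax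
    match l with
    | [] =>
      exfalso
      obtain ⟨v, hv⟩ : (W \ S).Nonempty := by
        rw [← Finset.card_pos, Finset.card_sdiff_of_subset hSW]; omega
      refine hno' ⟨[v], by simp [← hlm], by simp, by simp, by simpa using hv, ?_⟩
      intro u hu w hw h
      exact absurd (hs u hu w hw h) (by simp)
    | v :: l =>
      have hv := hm v (by simp)
      have hv' := Finset.mem_sdiff.1 hv
      rw [List.nodup_cons] at hd
      refine ⟨insert v S, Finset.insert_subset hv'.1 hSW, by rw [Finset.card_insert_of_notMem hv'.2, hSj],
        l, hc.tail, hd.2, ?_, ?_⟩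
      · intro x hx
        have := hm x (by simp [hx])
        have hne : x ≠ v := by rintro rfl; exact hd.1 hx
        simp only [Finset.mem_sdiff, Finset.mem_insert] at this ⊢
        tauto
      · intro u hu w hw huw
        simp only [Finset.mem_sdiff, Finset.mem_insert, not_or] at hw
        have hwS : w ∈ W \ S := by simp [hw]
        rcases Finset.mem_insert.1 hu with rfl | hu
        · by_contra hwl
          refine hno' ⟨w :: u :: l, by simpa using hlm, ?_, ?_, ?_, ?_⟩
          · exact List.isChain_cons_cons.2 ⟨huw.symm, hc⟩
          · simp only [List.nodup_cons, List.mem_cons, not_or]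
            exact ⟨⟨hw.2.1, hwl⟩, hd⟩
          · intro x hx
            rcases List.mem_cons.1 hx with rfl | hx
            · exact hwS
            · exact hm x hx
          · exact fun a ha b hb hab => List.mem_cons_of_mem _ (hs a ha b hb hab)
        · simpa [hw.2.1] using hs u hu w hwS huw

lemma exists_card_eq_card_outer_neighbors_lt {V : Type*} [DecidableEq V] {H : SimpleGraph V} {n : ℕ}
    (hH : ¬ (SimpleGraph.pathGraph n).IsContained H) (W : Finset V) (hn : n ≤ W.card) :
    ∃ S ⊆ W, S.card = n ∧ ∃ T : Finset V, T.card < n ∧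
      ∀ u ∈ S, ∀ w ∈ W \ S, H.Adj u w → w ∈ T := by
  obtain ⟨S, hS, hSn, l, hc, hd, -, hs⟩ := exists_finset_list_separating H W n hn
  refine ⟨S, hS, hSn, l.toFinset, ?_, by simpa using hs⟩
  rw [List.toFinset_card_of_nodup hd]
  by_contra! h
  exact hH (pathGraph_isContained_of_isChain hc hd h)

/-- Let `f` be a multigraph on `V` whose non-loop edges are edges of `H`. If `H` has no path on `n`
vertices and each set of `2 * n` vertices spans at most `b` edges of `f`, then `f` is sparse. -/
lemma card_edges_le_of_not_isContained {V ι : Type*} [DecidableEq V] [Fintype V] (I : Finset ι)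
    (f : ι → V × V) {H : SimpleGraph V} {n b : ℕ} (hn : 0 < n)
    (hf : ∀ i ∈ I, (f i).1 ≠ (f i).2 → H.Adj (f i).1 (f i).2)
    (hH : ¬ (SimpleGraph.pathGraph n).IsContained H) (hV : 2 * n ≤ Fintype.card V)
    (hb : ∀ S : Finset V, S.card = 2 * n → (I.filter fun i => (f i).1 ∈ S ∧ (f i).2 ∈ S).card ≤ b)
    (W : Finset V) :
    (I.filter fun i => (f i).1 ∈ W ∧ (f i).2 ∈ W).card ≤ b * (W.card / n + 1) := by
  have hb' : ∀ S : Finset V, S.card ≤ 2 * n →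
      (I.filter fun i => (f i).1 ∈ S ∧ (f i).2 ∈ S).card ≤ b := by
    intro S hS
    obtain ⟨S', hSS', hS'⟩ := Finset.exists_superset_card_eq hS hV
    refine le_trans (Finset.card_le_card ?_) (hb S' hS')
    exact Finset.monotone_filter_right _ fun i _ hi => ⟨hSS' hi.1, hSS' hi.2⟩
  induction hk : W.card using Nat.strong_induction_on generalizing W with
  | _ k ih =>
  subst hk
  by_cases hW : W.card < n
  · exact (hb' W (by omega)).trans (Nat.le_mul_of_pos_right _ (Nat.succ_pos _))
  · obtain ⟨S, hSW, hS, T, hT, hST⟩ := exists_card_eq_card_outer_neighbors_lt hH W (by omega)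
    have hcard : (W \ S).card = W.card - n := by rw [Finset.card_sdiff_of_subset hSW, hS]
    have h1 := ih (W \ S).card (by omega) (W \ S) rfl
    have h2 := hb' (S ∪ T) ((Finset.card_union_le _ _).trans (by omega))
    classical
    -- An edge in `W` that meets `S` has its other end in `S` or `T`; a loop at `S` stays in `S`.
    have hsub : (I.filter fun i => (f i).1 ∈ W ∧ (f i).2 ∈ W) ⊆
        (I.filter fun i => (f i).1 ∈ W \ S ∧ (f i).2 ∈ W \ S) ∪
        (I.filter fun i => (f i).1 ∈ S ∪ T ∧ (f i).2 ∈ S ∪ T) := by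
      intro i hi
      obtain ⟨hi, h⟩ := Finset.mem_filter.1 hi
      have ha := hf i hi
      have e1 := hST (f i).1
      have e2 := hST (f i).2
      have e3 := fun h => (ha h).symm
      simp only [Finset.mem_union, Finset.mem_filter, Finset.mem_sdiff] at e1 e2 ⊢
      grind
    have h3 := (Finset.card_le_card hsub).trans (Finset.card_union_le _ _)
    have h4 : W.card / n = (W.card - n) / n + 1 := by
      rw [← Nat.add_div_right _ hn]; congr 1; omega
    rw [hcard] at h1
    rw [h4]
    nlinarith

/-! ### The random multigraph -/

/-- The union bound for a uniformly random multigraph with `M` edges on `N` vertices. -/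
lemma exists_locally_sparse_multigraph {N M s t : ℕ} (hN : 0 < N) (htM : t ≤ M)
    (h : N.choose s * M.choose t * s ^ (2 * t) < N ^ (2 * t)) :
    ∃ f : Fin M → Fin N × Fin N, ∀ S : Finset (Fin N), S.card = s →
      (Finset.univ.filter fun i => (f i).1 ∈ S ∧ (f i).2 ∈ S).card < t := by
  by_contra! hcon
  -- The bad event for `(S, T)`: every edge indexed by `T` lies inside `S`.
  set P : Finset (Fin N) → Finset (Fin M) → Finset (Fin M → Fin N × Fin N) := fun S T =>
    Fintype.piFinset fun i => if i ∈ T then S ×ˢ S else Finset.univ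
  have hcard : ∀ S ∈ (Finset.univ : Finset (Fin N)).powersetCard s,
      ∀ T ∈ (Finset.univ : Finset (Fin M)).powersetCard t,
        (P S T).card = s ^ (2 * t) * N ^ (2 * (M - t)) := by
    intro S hS T hT
    obtain ⟨-, hS⟩ := Finset.mem_powersetCard.1 hS
    obtain ⟨-, hT⟩ := Finset.mem_powersetCard.1 hT
    have hTc : Tᶜ.card = M - t := by rw [Finset.card_compl, hT, Fintype.card_fin]
    simp only [P, Fintype.card_piFinset]
    rw [← Finset.prod_mul_prod_compl T]
    rw [Finset.prod_congr rfl (g := fun _ => s * s) fun i hi => by simp [hi, hS],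
      Finset.prod_congr (s₁ := Tᶜ) rfl (g := fun _ => N * N) fun i hi => by
        simp [Finset.mem_compl.1 hi], Finset.prod_const, Finset.prod_const, hT, hTc]
    ring
  have hcover : (Finset.univ : Finset (Fin M → Fin N × Fin N)) ⊆
      ((Finset.univ : Finset (Fin N)).powersetCard s).biUnion fun S =>
        ((Finset.univ : Finset (Fin M)).powersetCard t).biUnion fun T => P S T := by
    intro f _
    obtain ⟨S, hS, hf⟩ := hcon f
    obtain ⟨T, hT, hTt⟩ := Finset.exists_subset_card_eq hf
    simp only [Finset.mem_biUnion, Finset.mem_powersetCard, Finset.subset_univ, true_and]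
    refine ⟨S, hS, T, hTt, Fintype.mem_piFinset.2 fun i => ?_⟩
    split_ifs with hi
    · exact Finset.mem_product.2 (Finset.mem_filter.1 (hT hi)).2
    · exact Finset.mem_univ _
  have h1 := (Finset.card_le_card hcover).trans (Finset.card_biUnion_le_card_mul _ _
    (M.choose t * (s ^ (2 * t) * N ^ (2 * (M - t)))) fun S hS => by
      refine (Finset.card_biUnion_le_card_mul _ _ _ fun T hT => (hcard S hS T hT).le).trans ?_
      simp)
  have h2 : (Finset.univ : Finset (Fin M → Fin N × Fin N)).card =
      N ^ (2 * t) * N ^ (2 * (M - t)) := by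
    rw [← pow_add, Finset.card_univ]
    simp only [Fintype.card_fun, Fintype.card_prod, Fintype.card_fin]
    rw [← sq, ← pow_mul]; congr 1; omega
  rw [h2, Finset.card_powersetCard, Finset.card_univ, Fintype.card_fin] at h1
  have hpos : 0 < N ^ (2 * (M - t)) := by positivity
  nlinarith

lemma choose_mul_pow_le (N s : ℕ) : N.choose s * s ^ s ≤ (3 * N) ^ s := by
  have h1 := Nat.choose_le_pow_div (α := ℝ) s N
  have h2 := Real.pow_div_factorial_le_exp (s : ℝ) (by positivity) s
  have h3 : Real.exp s ≤ 3 ^ s := by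
    rw [← Real.exp_one_pow]
    exact pow_le_pow_left₀ (by positivity) Real.exp_one_lt_three.le s
  have hs : (0 : ℝ) < s.factorial := by positivity
  have : (N.choose s : ℝ) * s ^ s ≤ (3 * N) ^ s := by
    rw [le_div_iff₀ hs] at h1
    rw [div_le_iff₀ hs] at h2
    calc (N.choose s : ℝ) * s ^ s ≤ N.choose s * (3 ^ s * s.factorial) := by
          gcongr; exact h2.trans (by gcongr)
      _ = 3 ^ s * (N.choose s * s.factorial) := by ring
      _ ≤ 3 ^ s * N ^ s := by gcongr
      _ = _ := by rw [mul_pow]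
  exact_mod_cast this

lemma choose_mul_le_pow (c s : ℕ) (hs : 0 < s) : (c * s).choose s ≤ (3 * c) ^ s := by
  have h := choose_mul_pow_le (c * s) s
  rw [← mul_assoc, mul_pow] at h
  exact Nat.le_of_mul_le_mul_right h (by positivity)

/-- Since `72r < 2^(7+l)`, there are fewer than `2^t` vertex sets, a factor 2 per edge. What remains
is `2 · 147 · 4 = 1176 < 48²`. -/
lemma union_bound_lt {r l n : ℕ} (hr : 0 < r) (hrl : r ≤ 2 ^ l) (hn : 0 < n) :
    (48 * r * n).choose (2 * n) *
      (r * ((14 + 2 * l) * n) * (48 * r + 1)).choose ((14 + 2 * l) * n) *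
      (2 * n) ^ (2 * ((14 + 2 * l) * n)) < (48 * r * n) ^ (2 * ((14 + 2 * l) * n)) := by
  have h1 : (48 * r * n).choose (2 * n) < 2 ^ ((14 + 2 * l) * n) := by
    have := choose_mul_le_pow (24 * r) (2 * n) (by positivity)
    rw [show 24 * r * (2 * n) = 48 * r * n by ring] at this
    refine this.trans_lt ?_
    rw [show (14 + 2 * l) * n = (7 + l) * (2 * n) by ring, pow_mul 2]
    refine Nat.pow_lt_pow_left ?_ (by positivity)
    rw [pow_add]; omega
  set t := (14 + 2 * l) * n
  have ht : 0 < t := by positivity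
  have h2 : (r * t * (48 * r + 1)).choose t ≤ (147 * r ^ 2) ^ t := by
    rw [show r * t * (48 * r + 1) = r * (48 * r + 1) * t by ring]
    refine (choose_mul_le_pow _ t ht).trans (Nat.pow_le_pow_left ?_ t)
    nlinarith
  calc _ ≤ (48 * r * n).choose (2 * n) * (147 * r ^ 2) ^ t * (2 * n) ^ (2 * t) := by gcongr
    _ < 2 ^ t * (147 * r ^ 2) ^ t * (2 * n) ^ (2 * t) := by gcongr
    _ = (1176 * (r ^ 2 * n ^ 2)) ^ t := by
        rw [pow_mul (2 * n), ← mul_pow, ← mul_pow]; congr 1; ring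
    _ ≤ (2304 * (r ^ 2 * n ^ 2)) ^ t := by gcongr; norm_num
    _ = (48 * r * n) ^ (2 * t) := by rw [pow_mul (48 * r * n)]; congr 1; ring

/-! ### From local sparsity to the size Ramsey bound -/

lemma ramseyArrow_pathGraph_of_locally_sparse {N M r n t : ℕ} (hr : 0 < r) (hn : 0 < n)
    (hN : 2 * n ≤ N) (hM : r * ((t - 1) * (N / n + 1)) < M) (f : Fin M → Fin N × Fin N)
    (hf : ∀ S : Finset (Fin N), S.card = 2 * n →
      (Finset.univ.filter fun i => (f i).1 ∈ S ∧ (f i).2 ∈ S).card < t) :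
    RamseyArrow (SimpleGraph.fromEdgeSet (Set.range fun i => s((f i).1, (f i).2)))
      (SimpleGraph.pathGraph n) r := by
  classical
  set G := SimpleGraph.fromEdgeSet (Set.range fun i => s((f i).1, (f i).2))
  intro φ
  by_contra! hcon
  have hadj : ∀ i, (f i).1 ≠ (f i).2 → G.Adj (f i).1 (f i).2 := fun i hi =>
    (SimpleGraph.fromEdgeSet_adj _).2 ⟨⟨i, rfl⟩, hi⟩
  -- Loops get the default colour 0; the sparsity lemma tolerates loops in any class.
  set c : Fin M → Fin r := fun i =>
    if h : G.Adj (f i).1 (f i).2 then φ ⟨s((f i).1, (f i).2), h⟩ else ⟨0, hr⟩ with hc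
  have hcol : ∀ a : Fin r, (Finset.univ.filter fun i => c i = a).card ≤ (t - 1) * (N / n + 1) := by
    intro a
    have := card_edges_le_of_not_isContained (b := t - 1) (H := φ.labelGraph a)
      (Finset.univ.filter fun i => c i = a) f hn ?_ (not_nonempty_iff.2 (hcon a)) (by simpa using hN) ?_ Finset.univ
    · simpa using this
    · intro i hi hne
      rw [SimpleGraph.EdgeLabeling.labelGraph_adj]
      refine ⟨hadj i hne, ?_⟩
      simpa [hc, hadj i hne] using hi
    · intro S hS
      refine (Finset.card_le_card ?_).trans (Nat.le_sub_one_of_lt (hf S hS))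
      exact Finset.filter_subset_filter _ (Finset.subset_univ _)
  have hsum := Finset.card_eq_sum_card_fiberwise (s := Finset.univ) (t := Finset.univ) (f := c)
    (fun _ _ => Finset.mem_coe.2 (Finset.mem_univ _))
  have := Finset.sum_le_card_nsmul Finset.univ _ _ fun a _ => hcol a
  rw [← hsum] at this
  simp at this
  omega

lemma sizeRamseyNumber_le {W : Type*} {H : SimpleGraph W} {r N m : ℕ} {G : SimpleGraph (Fin N)}
    (h : RamseyArrow G H r) (hm : G.edgeSet.encard ≤ m) :
    ∃ k : ℕ, sizeRamseyNumber H r = (k : ℕ∞) ∧ k ≤ m := by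
  have h0 : sizeRamseyNumber H r ≤ G.edgeSet.encard := sInf_le ⟨N, G, h, rfl⟩
  have h1 : sizeRamseyNumber H r ≤ m := h0.trans hm
  obtain ⟨k, hk⟩ := ENat.ne_top_iff_exists.1 (ne_top_of_le_ne_top (ENat.natCast_ne_top m) h1)
  exact ⟨k, hk.symm, by rw [← hk] at h1; exact_mod_cast h1⟩

lemma sizeRamseyNumber_pathGraph_le {r l n : ℕ} (hr : 0 < r) (hrl : r ≤ 2 ^ l) (hn : 0 < n) :
    ∃ k : ℕ, sizeRamseyNumber (SimpleGraph.pathGraph n) r = (k : ℕ∞) ∧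
      k ≤ r * ((14 + 2 * l) * n) * (48 * r + 1) := by
  have ht : 0 < (14 + 2 * l) * n := by positivity
  obtain ⟨f, hf⟩ := exists_locally_sparse_multigraph
    (show 0 < 48 * r * n by positivity)
    (by rw [mul_assoc, mul_left_comm]; exact Nat.le_mul_of_pos_right _ (by positivity))
    (union_bound_lt hr hrl hn)
  refine sizeRamseyNumber_le
    (ramseyArrow_pathGraph_of_locally_sparse hr hn (by nlinarith) ?_ f hf) ?_
  · rw [Nat.mul_div_cancel _ hn, mul_assoc r]
    gcongr
    omega
  · rw [SimpleGraph.edgeSet_fromEdgeSet]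
    refine (Set.encard_le_encard Set.sdiff_subset).trans ?_
    rw [← Set.image_univ]
    exact (Set.encard_image_le _ _).trans (by simp)

lemma sizeRamseyNumber_pathGraph_one_le (n : ℕ) :
    ∃ k : ℕ, sizeRamseyNumber (SimpleGraph.pathGraph n) 1 = (k : ℕ∞) ∧ k ≤ n := by
  refine sizeRamseyNumber_le (G := SimpleGraph.pathGraph n) (fun φ => ⟨0, ?_⟩) ?_
  · refine SimpleGraph.IsContained.of_le fun x y h => ?_
    exact (SimpleGraph.EdgeLabeling.labelGraph_adj _ _).2 ⟨h, Subsingleton.elim _ _⟩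
  · have : (SimpleGraph.pathGraph n).edgeSet ⊆
        (fun i : Fin n => if h : (i : ℕ) + 1 < n then s(i, ⟨i + 1, h⟩) else s(i, i)) '' Set.univ := by
      intro e
      induction e using Sym2.ind with
      | _ a b =>
        intro h
        rw [SimpleGraph.mem_edgeSet, SimpleGraph.pathGraph_adj] at h
        rcases h with h | h
        · refine ⟨a, trivial, ?_⟩
          have hb := b.2
          simp [h]
        · refine ⟨b, trivial, ?_⟩
          have hb := a.2
          simp [h, Sym2.eq_swap]
    exact (Set.encard_le_encard this).trans ((Set.encard_image_le _ _).trans (by simp))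

lemma sizeRamseyNumber_pathGraph_le_log {r n : ℕ} (hr : 2 ≤ r) (hn : 0 < n) :
    ∃ k : ℕ, sizeRamseyNumber (SimpleGraph.pathGraph n) r = (k : ℕ∞) ∧
      (k : ℝ) ≤ 1400 * Real.log r * (r : ℝ) ^ 2 * n := by
  obtain ⟨k, hk, hkm⟩ := sizeRamseyNumber_pathGraph_le (l := Nat.clog 2 r) (by omega)
    (Nat.le_pow_clog one_lt_two r) hn
  refine ⟨k, hk, ?_⟩
  set l := Nat.clog 2 r
  have hl : 2 ^ (l - 1) < r := Nat.pow_pred_clog_lt_self one_lt_two (by omega)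
  have hl1 : 1 ≤ l := Nat.clog_pos one_lt_two hr
  have hr' : (2 : ℝ) ≤ r := by exact_mod_cast hr
  have h1 : (l - 1) * Real.log 2 ≤ Real.log r := by
    have : ((2 : ℝ) ^ (l - 1)) ≤ r := by exact_mod_cast hl.le
    have := Real.log_le_log (by positivity) this
    rwa [Real.log_pow, Nat.cast_sub hl1, Nat.cast_one] at this
  have h2 : Real.log 2 ≤ Real.log r := Real.log_le_log (by norm_num) hr'
  have h3 := Real.log_two_gt_d9
  have hl1' : (1 : ℝ) ≤ l := by exact_mod_cast hl1
  -- With `y = log₂ r ≥ 1`, `14 + 2l ≤ 16 + 2y ≤ 18y`, and `18 / log 2 < 28`.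
  have h4 : (14 + 2 * l : ℝ) ≤ 28 * Real.log r := by nlinarith
  have hkm' : (k : ℝ) ≤ r * ((14 + 2 * l) * n) * (48 * r + 1) := by exact_mod_cast hkm
  calc (k : ℝ) ≤ r * ((14 + 2 * l) * n) * (48 * r + 1) := hkm'
    _ ≤ r * ((28 * Real.log r) * n) * (50 * r) := by gcongr; linarith
    _ = _ := by ring

lemma tendsto_log_const_mul_log_div_log :
    Tendsto (fun r : ℕ => Real.log (1400 * Real.log r) / Real.log r) atTop (𝓝 0) := by
  have h1 : Tendsto (fun r : ℕ => 1400 * Real.log r) atTop atTop :=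
    (Real.tendsto_log_atTop.comp tendsto_natCast_atTop_atTop).const_mul_atTop (by norm_num)
  have h2 := (Real.isLittleO_log_id_atTop.tendsto_div_nhds_zero.comp h1).const_mul 1400
  rw [mul_zero] at h2
  refine h2.congr fun r => ?_
  simp only [Function.comp_apply, id]
  rw [← mul_div_assoc, mul_div_mul_left _ _ (by norm_num)]

theorem theorem4 :
    (∃ ε : ℕ → ℝ, Tendsto ε atTop (𝓝 0) ∧
      ∀ r : ℕ, 1 ≤ r → ∀ᶠ n : ℕ in atTop,
        ∃ m : ℕ, sizeRamseyNumber (SimpleGraph.pathGraph n) r = (m : ℕ∞) ∧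
          (m : ℝ) ≤ (r : ℝ) ^ (2 + ε r) * (n : ℝ)) ∧
    (∀ C : ℝ, 5 < C → ∀ r : ℕ, 2 ≤ r → ∀ᶠ n : ℕ in atTop,
      ∃ m : ℕ, sizeRamseyNumber (SimpleGraph.pathGraph n) r = (m : ℕ∞) ∧
        (m : ℝ) < (400 : ℝ) ^ 5 * C * (r : ℝ) ^ (2 + 1 / (C - 4)) * (n : ℝ)) := by
  refine ⟨⟨_, tendsto_log_const_mul_log_div_log, fun r hr => ?_⟩, fun C hC r hr => ?_⟩
  · filter_upwards [eventually_gt_atTop 0] with n hn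
    -- For `r = 1` the logarithmic bound degenerates to 0, while the target is `n`; the path itself
    -- suffices.
    rcases hr.eq_or_lt with rfl | hr
    · obtain ⟨m, hm, hmn⟩ := sizeRamseyNumber_pathGraph_one_le n
      exact ⟨m, hm, by simpa using hmn⟩
    · obtain ⟨m, hm, hmn⟩ := sizeRamseyNumber_pathGraph_le_log hr hn
      refine ⟨m, hm, hmn.trans_eq ?_⟩
      have hr' : (1 : ℝ) < r := by exact_mod_cast hr
      have hlog := Real.log_pos hr'
      rw [Real.rpow_add (by positivity), Real.rpow_def_of_pos (by positivity) (_ / _),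
        mul_div_cancel₀ _ hlog.ne', Real.exp_log (by positivity), Real.rpow_two]
      ring
  · filter_upwards [eventually_gt_atTop 0] with n hn
    obtain ⟨m, hm, hmn⟩ := sizeRamseyNumber_pathGraph_le_log hr hn
    refine ⟨m, hm, hmn.trans_lt ?_⟩
    have hr0 : (0 : ℝ) < r := by positivity
    have hn0 : (0 : ℝ) < n := by exact_mod_cast hn
    have hC4 : 0 < C - 4 := by linarith
    set x : ℝ := (r : ℝ) ^ (1 / (C - 4)) with hx
    have hx0 : 0 < x := by positivity
    -- `log r = (C - 4) log x ≤ (C - 4)(x - 1) < C x`.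
    have hlog : Real.log r < C * x := by
      have h1 : Real.log x = 1 / (C - 4) * Real.log r := Real.log_rpow hr0 _
      have h2 := Real.log_le_sub_one_of_pos hx0
      have h3 : Real.log r = (C - 4) * Real.log x := by rw [h1]; field_simp
      rw [h3]
      nlinarith
    rw [Real.rpow_add hr0, Real.rpow_two, ← hx]
    have hCx : 0 < C * x := by nlinarith
    calc 1400 * Real.log r * (r : ℝ) ^ 2 * n < 400 ^ 5 * (C * x) * (r : ℝ) ^ 2 * n := by
          gcongr ?_ * _ * _
          nlinarith
      _ = _ := by ring
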